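/- Let $F$ be a field of characteristic $5$ and let $n_1,n_2\ge 1$ be integers. Let $\mathcal O=\mathcal O(2;(n_1,n_2))$ be the divided power algebra over $F$ with basis $x_1^{(a)}x_2^{(b)}$, $0\le a<5^{n_1}$, $0\le b<5^{n_2}$, and product $x_1^{(a)}x_2^{(b)}\cdot x_1^{(c)}x_2^{(d)}=\binom{a+c}{a}\binom{b+d}{b}x_1^{(a+c)}x_2^{(b+d)}$ (read as $0$ when $a+c\ge 5^{n_1}$ or $b+d\ge 5^{n_2}$), let $\partial_1,\partial_2$ be the derivations of $\mathcal O$ with $\partial_1(x_1^{(a)}x_2^{(b)})=x_1^{(a-1)}x_2^{(b)}$ and $\partial_2(x_1^{(a)}x_2^{(b)})=x_1^{(a)}x_2^{(b-1)}$ (where $x_i^{(-1)}=0$), and let $W=\mathcal O\partial_1\oplus\mathcal O\partial_2$ be the Lie algebra $W(2;(n_1,n_2))$, with $\operatorname{div}(f_1\partial_1+f_2\partial_2)=\partial_1(f_1)+\partial_2(f_2)$. The Melikian algebra is $\mathcal M(n_1,n_2)=W\oplus\mathcal O\oplus\widetilde W$, where $\widetilde W=\{\widetilde E : E\in W\}$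 is a copy of the vector space $W$, with the Lie bracket that extends the one of $W$ and satisfies, for $D,E\in W$ and $f,g,f_i,g_i\in\mathcal O$, $$[D,\widetilde E]=\widetilde{[D,E]}+2\operatorname{div}(D)\widetilde E,\qquad [D,f]=D(f)-2\operatorname{div}(D)f,\qquad [f,\widetilde E]=fE,$$ $$[f,g]=2\,\bigl(f D_g-gD_f\bigr)^{\sim}\ \text{ with } D_f=\partial_1(f)\partial_2-\partial_2(f)\partial_1,\qquad [f_1\tilde\partial_1+f_2\tilde\partial_2,\;g_1\tilde\partial_1+g_2\tilde\partial_2]=f_1g_2-f_2g_1.$$ Then $\mathcal M(n_1,n_2)$ possesses a nondegenerate symmetric $F$-bilinear form $b$ that is invariant, i.e. $b([x,y],z)=-b(y,[x,z])$ for all $x,y,z\in\mathcal M(n_1,n_2)$. -/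

import Mathlib

/-- Formal divided power series in two variables `x₁, x₂` over `F`:
`f` stands for `∑ f a b • x₁^(a) x₂^(b)`. -/
def DPSeries (F : Type*) : Type _ := ℕ → ℕ → F

namespace DPSeries

open Finset

theorem ext {F : Type*} {f g : DPSeries F} (h : ∀ a b, f a b = g a b) : f = g :=
  funext fun a => funext fun b => h a b

variable {F : Type*} [Field F]

instance : AddCommGroup (DPSeries F) := inferInstanceAs (AddCommGroup (ℕ → ℕ → F))

instance : Module F (DPSeries F) := inferInstanceAs (Module F (ℕ → ℕ → F))

theorem add_apply (f g : DPSeries F) (a b : ℕ) : (f + g) a b = f a b + g a b := rfl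

theorem zero_apply (a b : ℕ) : (0 : DPSeries F) a b = 0 := rfl

theorem smul_apply (c : F) (f : DPSeries F) (a b : ℕ) : (c • f) a b = c * f a b := rfl

/-- The product determined by
`x₁^(a) x₂^(b) * x₁^(c) x₂^(d) = C(a+c, a) C(b+d, b) x₁^(a+c) x₂^(b+d)`. -/
instance : Mul (DPSeries F) where
  mul f g := fun a b => ∑ p ∈ antidiagonal a, ∑ q ∈ antidiagonal b,
    ((p.1 + p.2).choose p.1 : F) * ((q.1 + q.2).choose q.1 : F) * f p.1 q.1 * g p.2 q.2

/-- The unit `x₁^(0) x₂^(0)`. -/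
instance : One (DPSeries F) where
  one := fun a b => if a = 0 ∧ b = 0 then 1 else 0

theorem mul_apply (f g : DPSeries F) (a b : ℕ) :
    (f * g) a b = ∑ p ∈ antidiagonal a, ∑ q ∈ antidiagonal b,
      ((p.1 + p.2).choose p.1 : F) * ((q.1 + q.2).choose q.1 : F) * f p.1 q.1 * g p.2 q.2 := rfl

theorem one_apply (a b : ℕ) : (1 : DPSeries F) a b = if a = 0 ∧ b = 0 then 1 else 0 := rfl

theorem sum_triple {M : Type*} [AddCommMonoid M] (n : ℕ) (G : ℕ → ℕ → ℕ → M) :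
    ∑ p ∈ antidiagonal n, ∑ q ∈ antidiagonal p.1, G q.1 q.2 p.2
      = ∑ p ∈ antidiagonal n, ∑ q ∈ antidiagonal p.2, G p.1 q.1 q.2 := by
  rw [Finset.sum_sigma', Finset.sum_sigma']
  refine Finset.sum_bij' (fun x _ => ⟨(x.2.1, x.2.2 + x.1.2), (x.2.2, x.1.2)⟩)
    (fun x _ => ⟨(x.1.1 + x.2.1, x.2.2), (x.1.1, x.2.1)⟩) ?_ ?_ ?_ ?_ ?_ <;>
  · rintro ⟨⟨a, b⟩, ⟨c, d⟩⟩ h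
    simp only [mem_sigma, HasAntidiagonal.mem_antidiagonal] at h
    obtain ⟨h₁, h₂⟩ := h
    simp_all
    try omega

theorem choose_triple (i j k : ℕ) :
    (i + j + k).choose (i + j) * (i + j).choose i
      = (i + (j + k)).choose i * (j + k).choose j := by
  have := Nat.choose_mul (n := i + j + k) (k := i + j) (s := i) (by omega)
  rw [this]
  congr 2 <;> omega

protected theorem mul_comm (f g : DPSeries F) : f * g = g * f := by
  apply ext
  intro a b
  rw [mul_apply, mul_apply, ← Finset.Nat.sum_antidiagonal_swap]
  refine Finset.sum_congr rfl fun p _ => ?_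
  rw [← Finset.Nat.sum_antidiagonal_swap]
  refine Finset.sum_congr rfl fun q _ => ?_
  simp only [Prod.fst_swap, Prod.snd_swap]
  rw [Nat.add_comm p.2, Nat.add_comm q.2, ← Nat.choose_symm_add, ← Nat.choose_symm_add]
  ring

protected theorem one_mul (f : DPSeries F) : 1 * f = f := by
  apply ext
  intro a b
  rw [mul_apply, Finset.sum_eq_single (0, a), Finset.sum_eq_single (0, b)]
  · simp [one_apply]
  · rintro ⟨i, j⟩ h h'
    have : i ≠ 0 := by
      rintro rfl
      simp_all
    simp [one_apply, this]
  · simp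
  · rintro ⟨i, j⟩ h h'
    have : i ≠ 0 := by
      rintro rfl
      simp_all
    simp [one_apply, this]
  · simp

protected theorem left_distrib (f g h : DPSeries F) : f * (g + h) = f * g + f * h := by
  apply ext
  intro a b
  simp only [mul_apply, add_apply, mul_add, Finset.sum_add_distrib]

protected theorem smul_mul (c : F) (f g : DPSeries F) : (c • f) * g = c • (f * g) := by
  apply ext
  intro a b
  simp only [mul_apply, smul_apply, Finset.mul_sum]
  refine Finset.sum_congr rfl fun p _ => Finset.sum_congr rfl fun q _ => ?_
  ring

protected theorem mul_assoc (f g h : DPSeries F) : f * g * h = f * (g * h) := by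
  apply ext
  intro a b
  let G : ℕ → ℕ → ℕ → ℕ → ℕ → ℕ → F := fun i j k i' j' k' =>
    ((i + j + k).choose (i + j) * (i + j).choose i : ℕ) *
      ((i' + j' + k').choose (i' + j') * (i' + j').choose i' : ℕ) * f i i' * g j j' * h k k'
  have hl : (f * g * h) a b = ∑ p ∈ antidiagonal a, ∑ r ∈ antidiagonal p.1,
      ∑ q ∈ antidiagonal b, ∑ s ∈ antidiagonal q.1, G r.1 r.2 p.2 s.1 s.2 q.2 := by
    simp only [mul_apply, Finset.mul_sum, Finset.sum_mul]
    refine Finset.sum_congr rfl fun p _ => ?_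
    rw [Finset.sum_comm]
    refine Finset.sum_congr rfl fun r hr => Finset.sum_congr rfl fun q _ =>
      Finset.sum_congr rfl fun s hs => ?_
    simp only [G]
    rw [← HasAntidiagonal.mem_antidiagonal.mp hr, ← HasAntidiagonal.mem_antidiagonal.mp hs]
    push_cast
    ring
  have hr : (f * (g * h)) a b = ∑ p ∈ antidiagonal a, ∑ r ∈ antidiagonal p.2,
      ∑ q ∈ antidiagonal b, ∑ s ∈ antidiagonal q.2, G p.1 r.1 r.2 q.1 s.1 s.2 := by
    simp only [mul_apply, Finset.mul_sum]
    refine Finset.sum_congr rfl fun p _ => ?_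
    rw [Finset.sum_comm]
    refine Finset.sum_congr rfl fun r hr => Finset.sum_congr rfl fun q _ =>
      Finset.sum_congr rfl fun s hs => ?_
    simp only [G]
    rw [choose_triple, choose_triple, ← HasAntidiagonal.mem_antidiagonal.mp hr, ← HasAntidiagonal.mem_antidiagonal.mp hs]
    push_cast
    ring
  rw [hl, hr]
  rw [sum_triple a fun i j k => ∑ q ∈ antidiagonal b, ∑ s ∈ antidiagonal q.1,
    G i j k s.1 s.2 q.2]
  refine Finset.sum_congr rfl fun p _ => Finset.sum_congr rfl fun r _ => ?_
  exact sum_triple b fun i' j' k' => G p.1 r.1 r.2 i' j' k'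

instance : CommRing (DPSeries F) :=
  { (inferInstance : AddCommGroup (DPSeries F)), (inferInstance : Mul (DPSeries F)),
    (inferInstance : One (DPSeries F)) with
    mul_assoc := DPSeries.mul_assoc
    mul_comm := DPSeries.mul_comm
    one_mul := DPSeries.one_mul
    mul_one := fun f => by rw [DPSeries.mul_comm, DPSeries.one_mul]
    left_distrib := DPSeries.left_distrib
    right_distrib := fun f g h => by
      rw [DPSeries.mul_comm, DPSeries.left_distrib, DPSeries.mul_comm h, DPSeries.mul_comm h]
    zero_mul := fun f => ext fun a b => by simp [mul_apply, zero_apply]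
    mul_zero := fun f => ext fun a b => by simp [mul_apply, zero_apply] }

instance : Algebra F (DPSeries F) :=
  Algebra.ofModule DPSeries.smul_mul fun c f g => by
    rw [DPSeries.mul_comm, DPSeries.smul_mul, DPSeries.mul_comm]

/-- `x₁^(a) x₂^(b) ↦ x₁^(a-1) x₂^(b)`. -/
def shift₁ (f : DPSeries F) : DPSeries F := fun a b => f (a + 1) b

/-- `x₁^(a) x₂^(b) ↦ x₁^(a) x₂^(b-1)`. -/
def shift₂ (f : DPSeries F) : DPSeries F := fun a b => f a (b + 1)

theorem mul_succ_left (f g : DPSeries F) (a b : ℕ) :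
    (f * g) (a + 1) b = (f * shift₁ g) a b
      + (g * shift₁ f) a b := by
  have key : ∀ (u v : DPSeries F) (a b : ℕ), (u * v) a b = ∑ p ∈ antidiagonal a,
      (a.choose p.1 : F) * ∑ q ∈ antidiagonal b,
        ((q.1 + q.2).choose q.1 : F) * u p.1 q.1 * v p.2 q.2 := by
    intro u v a b
    rw [mul_apply]
    refine Finset.sum_congr rfl fun p hp => ?_
    rw [HasAntidiagonal.mem_antidiagonal.mp hp, Finset.mul_sum]
    exact Finset.sum_congr rfl fun q _ => by ring
  rw [DPSeries.mul_comm g, key, key, key]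
  rw [Finset.sum_antidiagonal_choose_succ_mul (fun i j => ∑ q ∈ antidiagonal b,
    ((q.1 + q.2).choose q.1 : F) * f i q.1 * g j q.2) a]
  congr 1
  refine Finset.sum_congr rfl fun p hp => ?_
  rw [← HasAntidiagonal.mem_antidiagonal.mp hp, Nat.choose_symm_add]
  rfl

theorem mul_succ_right (f g : DPSeries F) (a b : ℕ) :
    (f * g) a (b + 1) = (f * shift₂ g) a b
      + (g * shift₂ f) a b := by
  have key : ∀ (u v : DPSeries F) (a b : ℕ), (u * v) a b = ∑ q ∈ antidiagonal b,
      (b.choose q.1 : F) * ∑ p ∈ antidiagonal a,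
        ((p.1 + p.2).choose p.1 : F) * u p.1 q.1 * v p.2 q.2 := by
    intro u v a b
    rw [mul_apply, Finset.sum_comm]
    refine Finset.sum_congr rfl fun q hq => ?_
    rw [HasAntidiagonal.mem_antidiagonal.mp hq, Finset.mul_sum]
    exact Finset.sum_congr rfl fun p _ => by ring
  rw [DPSeries.mul_comm g, key, key, key]
  rw [Finset.sum_antidiagonal_choose_succ_mul (fun i j => ∑ p ∈ antidiagonal a,
    ((p.1 + p.2).choose p.1 : F) * f p.1 i * g p.2 j) b]
  congr 1
  refine Finset.sum_congr rfl fun p hp => ?_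
  rw [← HasAntidiagonal.mem_antidiagonal.mp hp, Nat.choose_symm_add]
  rfl

theorem choose_cast_eq_zero [CharP F 5] {n a b : ℕ} (ha : a < 5 ^ n) (hb : b < 5 ^ n)
    (h : 5 ^ n ≤ a + b) : ((a + b).choose a : F) = 0 := by
  rw [CharP.cast_eq_zero_iff F 5]
  have hn : n ≠ 0 := by
    rintro rfl
    simp at ha hb h
    omega
  have hp : Nat.Prime 5 := by norm_num
  apply Nat.dvd_of_factorization_pos
  rw [Nat.add_comm a b, Nat.factorization_choose' hp (Nat.lt_succ_self _)]
  apply Finset.card_ne_zero_of_mem (a := n)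
  have hlog : n ≤ Nat.log 5 (b + a) := by
    apply Nat.le_log_of_pow_le (by norm_num)
    omega
  rw [Finset.mem_filter, Finset.mem_Ico, Nat.mod_eq_of_lt ha, Nat.mod_eq_of_lt hb]
  omega

end DPSeries

open DPSeries in
/-- The divided power algebra `O(2; (n₁, n₂))` in characteristic `5`: the span of the
`x₁^(a) x₂^(b)` with `a < 5 ^ n₁` and `b < 5 ^ n₂`. -/
def DPAlg (F : Type*) [Field F] [CharP F 5] (n₁ n₂ : ℕ) : Subalgebra F (DPSeries F) where
  carrier := {f | ∀ a b, ¬(a < 5 ^ n₁ ∧ b < 5 ^ n₂) → f a b = 0}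
  add_mem' := fun {f g} hf hg a b h => by rw [DPSeries.add_apply, hf a b h, hg a b h, add_zero]
  mul_mem' := fun {f g} hf hg a b h => by
    rw [mul_apply]
    refine Finset.sum_eq_zero fun p hp => Finset.sum_eq_zero fun q hq => ?_
    rw [Finset.HasAntidiagonal.mem_antidiagonal] at hp hq
    by_cases h₁ : p.1 < 5 ^ n₁ ∧ q.1 < 5 ^ n₂
    · by_cases h₂ : p.2 < 5 ^ n₁ ∧ q.2 < 5 ^ n₂
      · by_cases h₃ : a < 5 ^ n₁
        · have h₄ : 5 ^ n₂ ≤ q.1 + q.2 := by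
            rw [hq]
            exact not_lt.mp fun h' => h ⟨h₃, h'⟩
          rw [choose_cast_eq_zero h₁.2 h₂.2 h₄]
          ring
        · have h₄ : 5 ^ n₁ ≤ p.1 + p.2 := by
            rw [hp]
            exact not_lt.mp h₃
          rw [choose_cast_eq_zero h₁.1 h₂.1 h₄]
          ring
      · rw [hg _ _ h₂, mul_zero]
    · rw [hf _ _ h₁, mul_zero, zero_mul]
  algebraMap_mem' := fun c a b h => by
    rw [Algebra.algebraMap_eq_smul_one, DPSeries.smul_apply, one_apply, if_neg, mul_zero]
    rintro ⟨rfl, rfl⟩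
    exact h ⟨by positivity, by positivity⟩

namespace DPAlg

open DPSeries

variable {F : Type*} [Field F] [CharP F 5] {n₁ n₂ : ℕ}

/-- The derivation `∂₁`, with `∂₁ (x₁^(a) x₂^(b)) = x₁^(a-1) x₂^(b)`. -/
def d₁ : Derivation F (DPAlg F n₁ n₂) (DPAlg F n₁ n₂) :=
  Derivation.mk'
    { toFun := fun f => ⟨shift₁ f.1, fun a b h => f.2 (a + 1) b fun h' =>
        h ⟨lt_trans (Nat.lt_succ_self a) h'.1, h'.2⟩⟩
      map_add' := fun _ _ => rfl
      map_smul' := fun _ _ => rfl }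
    fun f g => Subtype.ext <| DPSeries.ext fun a b =>
      DPSeries.mul_succ_left f.1 g.1 a b

/-- The derivation `∂₂`, with `∂₂ (x₁^(a) x₂^(b)) = x₁^(a) x₂^(b-1)`. -/
def d₂ : Derivation F (DPAlg F n₁ n₂) (DPAlg F n₁ n₂) :=
  Derivation.mk'
    { toFun := fun f => ⟨shift₂ f.1, fun a b h => f.2 a (b + 1) fun h' =>
        h ⟨h'.1, lt_trans (Nat.lt_succ_self b) h'.2⟩⟩
      map_add' := fun _ _ => rfl
      map_smul' := fun _ _ => rfl }
    fun f g => Subtype.ext <| DPSeries.ext fun a b =>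
      DPSeries.mul_succ_right f.1 g.1 a b

theorem d₁_d₂ (f : DPAlg F n₁ n₂) : d₁ (d₂ f) = d₂ (d₁ f) := rfl

end DPAlg

/-- The free `O(2; (n₁, n₂))`-module on `∂₁, ∂₂`, where `(f₁, f₂)` stands for `f₁ ∂₁ + f₂ ∂₂`;
it underlies the Jacobson–Witt algebra `W(2; (n₁, n₂))`. -/
abbrev VecField (F : Type*) [Field F] [CharP F 5] (n₁ n₂ : ℕ) : Type _ :=
  DPAlg F n₁ n₂ × DPAlg F n₁ n₂

namespace VecField

open DPAlg

variable {F : Type*} [Field F] [CharP F 5] {n₁ n₂ : ℕ}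

/-- The value `D(f)` of the derivation `D` at `f`. -/
def app (D : VecField F n₁ n₂) (f : DPAlg F n₁ n₂) : DPAlg F n₁ n₂ :=
  D.1 * d₁ f + D.2 * d₂ f

/-- The commutator `[D, E]` of derivations. -/
def lieComm (D E : VecField F n₁ n₂) : VecField F n₁ n₂ :=
  (app D E.1 - app E D.1, app D E.2 - app E D.2)

/-- The commutator is the commutator of the operators on `O(2; (n₁, n₂))`. -/
theorem app_lieComm (D E : VecField F n₁ n₂) (f : DPAlg F n₁ n₂) :
    app (lieComm D E) f = app D (app E f) - app E (app D f) := by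
  simp only [app, lieComm, map_add, Derivation.leibniz, smul_eq_mul, d₁_d₂]
  ring

/-- The divergence `div(f₁ ∂₁ + f₂ ∂₂) = ∂₁(f₁) + ∂₂(f₂)`. -/
def div (D : VecField F n₁ n₂) : DPAlg F n₁ n₂ := d₁ D.1 + d₂ D.2

/-- The Hamiltonian derivation `D_f = ∂₁(f) ∂₂ - ∂₂(f) ∂₁`. -/
def ham (f : DPAlg F n₁ n₂) : VecField F n₁ n₂ := (-d₂ f, d₁ f)

end VecField

/-- The Melikian algebra `M(n₁, n₂) = W ⊕ O ⊕ W~`, where `O = O(2; (n₁, n₂))`,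
`W = W(2; (n₁, n₂))` and `W~` is a copy of the vector space `W`. The triple `(D, f, E)` stands for
`D + f + E~`. -/
def Melikian (F : Type*) [Field F] [CharP F 5] (n₁ n₂ : ℕ) : Type _ :=
  VecField F n₁ n₂ × DPAlg F n₁ n₂ × VecField F n₁ n₂

namespace Melikian

open DPAlg VecField

variable {F : Type*} [Field F] [CharP F 5] {n₁ n₂ : ℕ}

instance : AddCommGroup (Melikian F n₁ n₂) :=
  inferInstanceAs (AddCommGroup (VecField F n₁ n₂ × DPAlg F n₁ n₂ × VecField F n₁ n₂))

instance : Module F (Melikian F n₁ n₂) :=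
  inferInstanceAs (Module F (VecField F n₁ n₂ × DPAlg F n₁ n₂ × VecField F n₁ n₂))

/-- The component in `W`. -/
def vec (x : Melikian F n₁ n₂) : VecField F n₁ n₂ := x.1

/-- The component in `O`. -/
def fn (x : Melikian F n₁ n₂) : DPAlg F n₁ n₂ := x.2.1

/-- The component in `W~`. -/
def tilde (x : Melikian F n₁ n₂) : VecField F n₁ n₂ := x.2.2

/-- The antisymmetric bilinear product with
`[D, E]` the commutator of `W`,
`[D, E~] = [D, E]~ + 2 div(D) E~`,
`[D, f] = D(f) - 2 div(D) f`,
`[f, E~] = f E`,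
`[f, g] = 2 (f D_g - g D_f)~`,
`[(f₁ ∂₁ + f₂ ∂₂)~, (g₁ ∂₁ + g₂ ∂₂)~] = f₁ g₂ - f₂ g₁`. -/
instance : Bracket (Melikian F n₁ n₂) (Melikian F n₁ n₂) where
  bracket x y :=
    (lieComm x.vec y.vec + (x.fn • y.tilde - y.fn • x.tilde),
      (app x.vec y.fn - 2 * div x.vec * y.fn) - (app y.vec x.fn - 2 * div y.vec * x.fn)
        + (x.tilde.1 * y.tilde.2 - x.tilde.2 * y.tilde.1),
      (lieComm x.vec y.tilde + (2 * div x.vec) • y.tilde)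
        - (lieComm y.vec x.tilde + (2 * div y.vec) • x.tilde)
        + (2 : DPAlg F n₁ n₂) • (x.fn • ham y.fn - y.fn • ham x.fn))

theorem five_eq_zero : (5 : DPAlg F n₁ n₂) = 0 := by
  have h : (5 : F) = 0 := by exact_mod_cast CharP.cast_eq_zero F 5
  have h' := congrArg (algebraMap F (DPAlg F n₁ n₂)) h
  rwa [map_ofNat, map_zero] at h'

theorem ext {x y : Melikian F n₁ n₂} (h₁ : x.vec.1 = y.vec.1) (h₂ : x.vec.2 = y.vec.2)
    (h₃ : x.fn = y.fn) (h₄ : x.tilde.1 = y.tilde.1) (h₅ : x.tilde.2 = y.tilde.2) : x = y :=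
  Prod.ext (Prod.ext h₁ h₂) (Prod.ext h₃ (Prod.ext h₄ h₅))

variable (x y z : Melikian F n₁ n₂) (c : F)

theorem vec_add : (x + y).vec = x.vec + y.vec := rfl

theorem fn_add : (x + y).fn = x.fn + y.fn := rfl

theorem tilde_add : (x + y).tilde = x.tilde + y.tilde := rfl

theorem vec_smul : (c • x).vec = c • x.vec := rfl

theorem fn_smul : (c • x).fn = c • x.fn := rfl

theorem tilde_smul : (c • x).tilde = c • x.tilde := rfl

theorem vec_lie : ⁅x, y⁆.vec = lieComm x.vec y.vec + (x.fn • y.tilde - y.fn • x.tilde) := rfl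

theorem fn_lie : ⁅x, y⁆.fn =
    (app x.vec y.fn - 2 * div x.vec * y.fn) - (app y.vec x.fn - 2 * div y.vec * x.fn)
      + (x.tilde.1 * y.tilde.2 - x.tilde.2 * y.tilde.1) := rfl

theorem tilde_lie : ⁅x, y⁆.tilde =
    (lieComm x.vec y.tilde + (2 * div x.vec) • y.tilde)
      - (lieComm y.vec x.tilde + (2 * div y.vec) • x.tilde)
      + (2 : DPAlg F n₁ n₂) • (x.fn • ham y.fn - y.fn • ham x.fn) := rfl

theorem d₁_two : d₁ (2 : DPAlg F n₁ n₂) = 0 := by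
  exact_mod_cast (d₁ : Derivation F (DPAlg F n₁ n₂) (DPAlg F n₁ n₂)).map_natCast 2

theorem d₂_two : d₂ (2 : DPAlg F n₁ n₂) = 0 := by
  exact_mod_cast (d₂ : Derivation F (DPAlg F n₁ n₂) (DPAlg F n₁ n₂)).map_natCast 2

protected theorem add_lie : ⁅x + y, z⁆ = ⁅x, z⁆ + ⁅y, z⁆ := by
  apply ext <;>
  · simp only [vec_lie, fn_lie, tilde_lie, vec_add, fn_add, tilde_add, lieComm, app, div, ham,
      Prod.fst_add, Prod.snd_add, Prod.fst_sub, Prod.snd_sub, Prod.smul_fst, Prod.smul_snd,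
      smul_eq_mul, map_add]
    ring

protected theorem lie_add : ⁅x, y + z⁆ = ⁅x, y⁆ + ⁅x, z⁆ := by
  apply ext <;>
  · simp only [vec_lie, fn_lie, tilde_lie, vec_add, fn_add, tilde_add, lieComm, app, div, ham,
      Prod.fst_add, Prod.snd_add, Prod.fst_sub, Prod.snd_sub, Prod.smul_fst, Prod.smul_snd,
      smul_eq_mul, map_add]
    ring

protected theorem lie_smul : ⁅x, c • y⁆ = c • ⁅x, y⁆ := by
  apply ext <;>
  · simp only [vec_lie, fn_lie, tilde_lie, vec_smul, fn_smul, tilde_smul, lieComm, app, div, ham,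
      Prod.fst_add, Prod.snd_add, Prod.fst_sub, Prod.snd_sub, Prod.smul_fst, Prod.smul_snd,
      smul_eq_mul]
    simp only [Derivation.map_smul]
    simp only [Algebra.smul_def]
    ring

protected theorem lie_self : ⁅x, x⁆ = 0 := by
  apply ext
  · change ⁅x, x⁆.vec.1 = 0
    simp [vec_lie, lieComm]
  · change ⁅x, x⁆.vec.2 = 0
    simp [vec_lie, lieComm]
  · change ⁅x, x⁆.fn = 0
    rw [fn_lie]
    ring
  · change ⁅x, x⁆.tilde.1 = 0
    simp [tilde_lie]
  · change ⁅x, x⁆.tilde.2 = 0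
    simp [tilde_lie]

set_option maxHeartbeats 1600000 in
protected theorem leibniz_lie : ⁅x, ⁅y, z⁆⁆ = ⁅⁅x, y⁆, z⁆ + ⁅y, ⁅x, z⁆⁆ := by
  have h5 := five_eq_zero (F := F) (n₁ := n₁) (n₂ := n₂)
  have h10 : (10 : DPAlg F n₁ n₂) = 0 := by linear_combination 2 * h5
  apply ext <;>
  · simp only [vec_lie, fn_lie, tilde_lie, vec_add, fn_add, tilde_add, lieComm, app, div, ham,
      Prod.fst_add, Prod.snd_add, Prod.fst_sub, Prod.snd_sub, Prod.smul_fst, Prod.smul_snd,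
      smul_eq_mul, map_add, map_sub, map_neg, Derivation.leibniz, d₁_two, d₂_two, d₁_d₂]
    rw [← sub_eq_zero]
    ring_nf
    try simp only [h5, h10, mul_zero, add_zero, sub_zero, neg_zero]

instance : LieRing (Melikian F n₁ n₂) where
  add_lie := Melikian.add_lie
  lie_add := Melikian.lie_add
  lie_self := Melikian.lie_self
  leibniz_lie := Melikian.leibniz_lie

instance : LieAlgebra F (Melikian F n₁ n₂) where
  lie_smul c x y := Melikian.lie_smul x y c

end Melikian

/-! The form is b(x, y) = ∫ ⟨x, y⟩. Here ⟨·,·⟩ is an `O`-valued symmetric pairing that couples `W`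
with `W~` by the determinant and `O` with itself by the product, and ∫ reads off the coefficient of
the top monomial.

Invariance: ⟨[x, y], z⟩ + ⟨y, [x, z]⟩ is always a divergence (`pairing_lie_add`), and ∫ kills
divergences, because the top monomial never occurs in a partial derivative (`integral_d₁`,
`integral_d₂`).

Nondegeneracy: the determinant and the product are perfect over `O`, so it is enough that (f, g) ↦ ∫
fg is nondegenerate on `O` (`eq_zero_of_integral_mul`). This holds because the binomial coefficients
of 5^n - 1 are ±1 modulo 5. -/

namespace DPSeries

/-! ### Binomial coefficients modulo 5 and products with monomials. -/

variable {F : Type*} [Field F]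

theorem choose_pow_sub_one_cast [CharP F 5] (n a : ℕ) (ha : a < 5 ^ n) :
    ((5 ^ n - 1).choose a : F) = (-1) ^ a := by
  induction a with
  | zero => simp
  | succ k ih =>
    have hk : k < 5 ^ n := Nat.lt_of_succ_lt ha
    -- Row 5^n of Pascal's triangle vanishes modulo 5 strictly between its ends, so neighbouring
    -- entries of row 5^n - 1 are opposite.
    have h0 : ((5 ^ n).choose (k + 1) : F) = 0 := by
      rw [CharP.cast_eq_zero_iff F 5]
      exact (show Nat.Prime 5 by norm_num).dvd_choose_pow (Nat.succ_ne_zero k) ha.ne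
    obtain ⟨m, hm⟩ : ∃ m, 5 ^ n = m + 1 := ⟨5 ^ n - 1, by omega⟩
    rw [hm, Nat.add_sub_cancel] at ih
    rw [hm, Nat.choose_succ_succ, Nat.cast_add, ih (by omega)] at h0
    rw [hm, Nat.add_sub_cancel, pow_succ]
    linear_combination h0

/-- The monomial `x₁^(c) x₂^(d)`. -/
def monomial (c d : ℕ) : DPSeries F := fun a b => if a = c ∧ b = d then 1 else 0

theorem mul_monomial_apply (f : DPSeries F) (a b c d : ℕ) :
    (f * monomial c d : DPSeries F) (a + c) (b + d) = ((a + c).choose a : F) * (b + d).choose b * f a b := by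
  rw [mul_apply, Finset.sum_eq_single (a, c), Finset.sum_eq_single (b, d)]
  · simp [monomial]
  · rintro ⟨i, j⟩ h h'
    have : j ≠ d := by
      rintro rfl
      simp_all
    simp [monomial, this]
  · simp
  · rintro ⟨i, j⟩ h h'
    have : j ≠ c := by
      rintro rfl
      simp_all
    simp [monomial, this]
  · simp

end DPSeries

/-! ### Integration on the divided power algebra. -/

namespace DPAlg

variable {F : Type*} [Field F] [CharP F 5] {n₁ n₂ : ℕ}

/-- The Berezin-type integral on `O(2; (n₁, n₂))`: the coefficient of the monomial of highest
degree. -/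
def integral : DPAlg F n₁ n₂ →ₗ[F] F where
  toFun f := f.1 (5 ^ n₁ - 1) (5 ^ n₂ - 1)
  map_add' _ _ := rfl
  map_smul' _ _ := rfl

/-- The coefficient in question is that of `f` at first exponent 5^n₁, just outside the truncation.
-/
theorem integral_d₁ (f : DPAlg F n₁ n₂) : integral (d₁ f) = 0 :=
  f.2 (5 ^ n₁ - 1 + 1) (5 ^ n₂ - 1) fun h => by omega

theorem integral_d₂ (f : DPAlg F n₁ n₂) : integral (d₂ f) = 0 :=
  f.2 (5 ^ n₁ - 1) (5 ^ n₂ - 1 + 1) fun h => by omega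

/-- The pairing `(f, g) ↦ ∫ f g` on `O(2; (n₁, n₂))` is nondegenerate. -/
theorem eq_zero_of_integral_mul (f : DPAlg F n₁ n₂) (h : ∀ g, integral (f * g) = 0) : f = 0 := by
  refine Subtype.ext (DPSeries.ext fun a b => ?_)
  by_cases hab : a < 5 ^ n₁ ∧ b < 5 ^ n₂
  -- Multiplying by the complementary monomial x₁^(c) x₂^(d) moves the (a, b) coefficient of `f`,
  -- and no other, to the top degree, up to a sign.
  · obtain ⟨c, hc⟩ : ∃ c, 5 ^ n₁ - 1 = a + c := Nat.exists_eq_add_of_le (by omega)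
    obtain ⟨d, hd⟩ : ∃ d, 5 ^ n₂ - 1 = b + d := Nat.exists_eq_add_of_le (by omega)
    have hfg : (f.1 * DPSeries.monomial c d : DPSeries F) (5 ^ n₁ - 1) (5 ^ n₂ - 1) = 0 :=
      h ⟨DPSeries.monomial c d, fun i j hij => if_neg fun h' => hij (by omega)⟩
    rw [hc, hd, DPSeries.mul_monomial_apply, ← hc, ← hd,
      DPSeries.choose_pow_sub_one_cast n₁ a hab.1,
      DPSeries.choose_pow_sub_one_cast n₂ b hab.2] at hfg
    simpa [DPSeries.zero_apply] using hfg
  · exact f.2 a b hab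

end DPAlg

/-! ### The pairing, the invariant form and its properties. -/

namespace Melikian

open DPAlg VecField

variable {F : Type*} [Field F] [CharP F 5] {n₁ n₂ : ℕ}

/-- The `O`-valued symmetric pairing whose integral is the invariant form: `W` is paired with `W~`
by the determinant and `O` with itself by the product. -/
def pairing (x y : Melikian F n₁ n₂) : DPAlg F n₁ n₂ :=
  (x.vec.1 * y.tilde.2 - x.vec.2 * y.tilde.1) + (y.vec.1 * x.tilde.2 - y.vec.2 * x.tilde.1)
    + x.fn * y.fn

theorem pairing_comm (x y : Melikian F n₁ n₂) : pairing x y = pairing y x := by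
  unfold pairing
  ring

theorem pairing_add_left (x y z : Melikian F n₁ n₂) :
    pairing (x + y) z = pairing x z + pairing y z := by
  simp only [pairing, vec_add, fn_add, tilde_add, Prod.fst_add, Prod.snd_add]
  ring

theorem pairing_smul_left (c : F) (x y : Melikian F n₁ n₂) :
    pairing (c • x) y = c • pairing x y := by
  simp only [pairing, vec_smul, fn_smul, tilde_smul, Prod.smul_fst, Prod.smul_snd]
  simp only [Algebra.smul_def]
  ring

/-- The vector field whose divergence is the defect of invariance of the pairing. -/
def flux (x y z : Melikian F n₁ n₂) : VecField F n₁ n₂ :=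
  pairing y z • x.vec
    + (2 * x.fn * y.fn - (y.vec.1 * x.tilde.2 - y.vec.2 * x.tilde.1)) • z.vec
    + (2 * x.fn * z.fn - (z.vec.1 * x.tilde.2 - z.vec.2 * x.tilde.1)) • y.vec

set_option maxHeartbeats 1600000 in
-- With `W`, `O`, `W~` in degrees 0, 1, 2 modulo 3, only triples of total degree 2 contribute. For x
-- = D in `W`, the determinant contributes -div(D) and the twist of `W~` adds 2 div(D), while a
-- product of two functions gets -4 div(D). Both totals equal div(D) modulo 5, so the pairing h =
-- ⟨y, z⟩ transforms as a density: D(h) + div(D) h = div(hD). For x, y in `O` and z in `W`, the sum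
-- is div(2xyz), again only modulo 5. The remaining terms of `flux` treat x in `W~` with y, z in
-- `W`. For two arguments in `W~` and one in `O` the sum is zero.
theorem pairing_lie_add (x y z : Melikian F n₁ n₂) :
    pairing ⁅x, y⁆ z + pairing y ⁅x, z⁆ = div (flux x y z) := by
  have h5 := five_eq_zero (F := F) (n₁ := n₁) (n₂ := n₂)
  simp only [flux, pairing, vec_lie, fn_lie, tilde_lie, lieComm, app, div, ham,
    Prod.fst_add, Prod.snd_add, Prod.fst_sub, Prod.snd_sub, Prod.smul_fst, Prod.smul_snd,
    smul_eq_mul, map_add, map_sub, Derivation.leibniz, d₁_two, d₂_two]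
  rw [← sub_eq_zero]
  ring_nf
  -- The identity holds only modulo 5: every term that survives normalization carries a factor 5.
  simp only [h5, mul_zero, sub_zero, neg_zero]

/-- The invariant form on the Melikian algebra. -/
def form : LinearMap.BilinForm F (Melikian F n₁ n₂) :=
  LinearMap.mk₂ F (fun x y => integral (pairing x y))
    (fun x y z => by rw [pairing_add_left, map_add])
    (fun c x y => by rw [pairing_smul_left, map_smul])
    (fun x y z => by rw [pairing_comm, pairing_add_left, map_add, pairing_comm y, pairing_comm z])
    (fun c x y => by rw [pairing_comm, pairing_smul_left, map_smul, pairing_comm y])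

theorem form_apply (x y : Melikian F n₁ n₂) : form x y = integral (pairing x y) := rfl

theorem form_isSymm : (form : LinearMap.BilinForm F (Melikian F n₁ n₂)).IsSymm :=
  ⟨fun x y => congrArg integral (pairing_comm x y)⟩

theorem form_lieInvariant :
    (form : LinearMap.BilinForm F (Melikian F n₁ n₂)).lieInvariant (Melikian F n₁ n₂) := by
  intro x y z
  rw [eq_neg_iff_add_eq_zero, form_apply, form_apply, ← map_add, pairing_lie_add, div, map_add,
    integral_d₁, integral_d₂, add_zero]

theorem eq_zero_of_form_eq_zero (x : Melikian F n₁ n₂) (h : ∀ y, form x y = 0) : x = 0 := by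
  -- A test vector with a single nonzero coordinate g isolates one coordinate of `x`: by the
  -- determinant, the opposite coordinate in the dual summand. The resulting sign is harmless.
  have key (D : VecField F n₁ n₂) (f : DPAlg F n₁ n₂) (E : VecField F n₁ n₂) :
      integral ((x.vec.1 * E.2 - x.vec.2 * E.1) + (D.1 * x.tilde.2 - D.2 * x.tilde.1)
        + x.fn * f) = 0 := h (D, f, E)
  refine ext ?_ ?_ ?_ ?_ ?_ <;> refine eq_zero_of_integral_mul _ fun g => ?_
  · simpa using key 0 0 (0, g)
  · simpa using key 0 0 (g, 0)
  · simpa using key 0 g 0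
  · simpa [mul_comm] using key (0, g) 0 0
  · simpa [mul_comm] using key (g, 0) 0 0

theorem form_nondegenerate : (form : LinearMap.BilinForm F (Melikian F n₁ n₂)).Nondegenerate :=
  -- Nondegeneracy asks for both kernels to vanish; symmetry carries the left one to the right.
  ⟨eq_zero_of_form_eq_zero, fun y h => eq_zero_of_form_eq_zero y fun x => by
    rw [form_apply, pairing_comm]; exact h x⟩

end Melikian

theorem mainTheorem7 (F : Type*) [Field F] [CharP F 5] (n₁ n₂ : ℕ) (hn₁ : 1 ≤ n₁) (hn₂ : 1 ≤ n₂) :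
    ∃ b : LinearMap.BilinForm F (Melikian F n₁ n₂),
      b.Nondegenerate ∧ b.IsSymm ∧ b.lieInvariant (Melikian F n₁ n₂) :=
  ⟨Melikian.form, Melikian.form_nondegenerate, Melikian.form_isSymm, Melikian.form_lieInvariant⟩
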